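/- Let $(Y,d)$ be a complete metric space. A geodesic path is a distance-preserving map $[0,l]\to Y$, a geodesic ray is a distance-preserving map $[0,\infty)\to Y$. Assume that: - $Y$ is geodesic (any two points are joined by a geodesic path) and Busemann convex: for all geodesic paths $\gamma_i:[0,l_i]\to Y$ ($i=1,2$) with $\gamma_1(0)=\gamma_2(0)$ and all $t\in[0,1]$, $d(\gamma_1(tl_1),\gamma_2(tl_2))\le t\,d(\gamma_1(l_1),\gamma_2(l_2))$; - $Y$ is weakly uniformly convex: for all $a\in Y$, $r>0$, $\varepsilon\in(0,2]$, $$\delta_Y(a,r,\varepsilon)=\inf\{1-d(a,m)/r \;:\; d(a,x)\le r,\ d(a,y)\le r,\ d(x,y)\ge\varepsilon r,\ m \text{ a midpoint of } x \text{ and } y\}>0$$ (with $\inf\emptyset=+\infty$); - for every $a\in Y$ and $\varepsilon>0$ there is $s>0$ with $\inf_{r\ge s}\delta_Y(a,r,\varepsilon)>0$. Let $D\subseteq Y$, let $S$ be a semigroup (under composition) of nonexpansive (i.e. $1$-Lipschitz) maps $D\to D$, with the Borel $\sigma$-algebra of the compact-open topology. Let $(X,\mu)$ be a probability space, $T:X\to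 X$ an ergodic measure-preserving transformation and $w:X\to S$ a measurable map; put $a_n(x)=w(x)w(Tx)\cdots w(T^{n-1}x)$. Fix $y\in D$, assume that the functions $x\mapsto d(y,a_n(x)y)$ are $\mu$-measurable (which is automatic if $D$ is separable) and that $\int_X d(y,a_1(x)y)\,d\mu(x)<\infty$, and let $$A=\lim_{n\to\infty}\frac1n\int_X d(y,a_n(x)y)\,d\mu(x).$$ If $A>0$, then for $\mu$-almost every $x\in X$ there is a unique geodesic ray $\gamma:[0,\infty)\to Y$ with $\gamma(0)=y$ and $$\lim_{n\to\infty}\frac1n\,d(\gamma(An),a_n(x)y)=0.$$ -/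

import Mathlib

open Filter Topology MeasureTheory
open scoped NNReal

noncomputable section

namespace GeodErg

/-- The map `γ` restricted to `[0, l]` is a geodesic path, that is, it preserves distances. -/
def IsGeodesicPath {Y : Type*} [MetricSpace Y] (l : ℝ) (γ : ℝ → Y) : Prop :=
  0 ≤ l ∧ ∀ s ∈ Set.Icc (0 : ℝ) l, ∀ t ∈ Set.Icc (0 : ℝ) l, dist (γ s) (γ t) = |s - t|

/-- A geodesic ray issuing at `y`: a distance-preserving map on `[0, ∞)` that starts at `y`. -/
def IsGeodesicRay {Y : Type*} [MetricSpace Y] (y : Y) (γ : ℝ≥0 → Y) : Prop :=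
  Isometry γ ∧ γ 0 = y

/-- Every two points are joined by a geodesic path. -/
def IsGeodesicSpace (Y : Type*) [MetricSpace Y] : Prop :=
  ∀ x y : Y, ∃ (l : ℝ) (γ : ℝ → Y), IsGeodesicPath l γ ∧ γ 0 = x ∧ γ l = y

/-- Busemann convexity (of a geodesic space). -/
def IsBusemannConvex (Y : Type*) [MetricSpace Y] : Prop :=
  ∀ (l₁ l₂ : ℝ) (γ₁ γ₂ : ℝ → Y), IsGeodesicPath l₁ γ₁ → IsGeodesicPath l₂ γ₂ → γ₁ 0 = γ₂ 0 →
    ∀ t ∈ Set.Icc (0 : ℝ) 1, dist (γ₁ (t * l₁)) (γ₂ (t * l₂)) ≤ t * dist (γ₁ l₁) (γ₂ l₂)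

/-- `m` is a midpoint of `x` and `y`. In a geodesic space these are exactly the midpoints of the
geodesic segments from `x` to `y`. -/
def IsMidpoint {Y : Type*} [MetricSpace Y] (x y m : Y) : Prop :=
  dist x m = dist x y / 2 ∧ dist y m = dist x y / 2

/-- The modulus of convexity `δ_Y(a, r, ε)`. The infimum is taken in the extended reals, so that
the infimum of the empty set is `+∞`. -/
def modulus {Y : Type*} [MetricSpace Y] (a : Y) (r ε : ℝ) : EReal :=
  sInf {t : EReal | ∃ x y m : Y, dist a x ≤ r ∧ dist a y ≤ r ∧ ε * r ≤ dist x y ∧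
    IsMidpoint x y m ∧ t = ((1 - dist a m / r : ℝ) : EReal)}

/-- Weak uniform convexity: the modulus of convexity is positive. -/
def IsWeaklyUniformlyConvex (Y : Type*) [MetricSpace Y] : Prop :=
  ∀ (a : Y) (r ε : ℝ), 0 < r → 0 < ε → ε ≤ 2 → 0 < modulus a r ε

/-- For all `a` and `ε > 0` there is `s > 0` such that `inf_{r ≥ s} δ_Y(a, r, ε) > 0`. -/
def HasLargeScaleModulus (Y : Type*) [MetricSpace Y] : Prop :=
  ∀ (a : Y) (ε : ℝ), 0 < ε → ∃ s : ℝ, 0 < s ∧ 0 < ⨅ r ∈ Set.Ici s, modulus a r ε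

/-- `S` is a semigroup (under composition) of nonexpansive self-mappings of `D`. -/
def IsNonexpansiveSemigroup {D : Type*} [MetricSpace D] (S : Set C(D, D)) : Prop :=
  (∀ f ∈ S, LipschitzWith 1 f) ∧ ∀ f ∈ S, ∀ g ∈ S, f.comp g ∈ S

/-- The cocycle `a_n(x) = w(x) w(Tx) ⋯ w(T^{n-1}x)`, with `a_0(x)` the identity. -/
def cocycle {X D : Type*} [MetricSpace D] {S : Set C(D, D)} (T : X → X) (w : X → S) :
    ℕ → X → C(D, D)
  | 0, _ => ContinuousMap.id D
  | n + 1, x => (cocycle T w n x).comp (w (T^[n] x) : C(D, D))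

/-- The drift `A = lim (1/n) ∫ d(y, a_n(x) y) dμ(x)`. -/
def drift {X D : Type*} [MeasurableSpace X] [MetricSpace D] {S : Set C(D, D)} (μ : Measure X)
    (T : X → X) (w : X → S) (y : D) : ℝ :=
  limUnder atTop (fun n : ℕ => (1 / (n : ℝ)) * ∫ x, dist y (cocycle T w n x y) ∂μ)

end GeodErg

end

/-! Write f_n(x) = d(y, a_n(x)y) and u_n = a_n(x)y. Since a_{n+m}(x) = a_n(x) a_m(T^n x) with a_n(x)
nonexpansive, f is a subadditive cocycle and d(u_k, u_n) ≤ f_{n-k}(T^k x).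

Ergodic half: almost every x has, for each ε > 0, infinitely many times n with f_{n-k}(T^k x) + (A -
ε)k ≤ f_n(x) for all k from some K up to n (`ae_mem_goodSet`). At such n each earlier u_k lies
almost on a geodesic from y to u_n. This also yields the lower bound in Kingman's theorem, hence
Birkhoff's theorem, and from Birkhoff the upper bound, so f_n(x)/n → A.

Geometric half: uniform convexity at large scale forces u_k to within o(k) of the point of [y, u_n]
at distance about Ak from y (`exists_dist_le_of_almost_geodesic`). Busemann convexity carries this
back to every t, so the geodesics [y, u_k] differ at parameter t by at most ηt
(`exists_dist_path_le`). By completeness they converge to a ray; the bound linear in t makes the ray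
follow u_n sublinearly. Uniqueness is Busemann convexity again. -/

noncomputable section

namespace GeodErg

/-! ### Subadditive cocycles: leading times, Birkhoff's theorem and Kingman's bounds. -/

section Ergodic

variable {X : Type*}

/-- The points `x` at which `c n x` dominates all the values `c (n - k) (T^k x)`. -/
def leadingSet (T : X → X) (c : ℕ → X → ℝ) (n : ℕ) : Set X :=
  {x | ∀ k ≤ n, c (n - k) (T^[k] x) ≤ c n x}

/-- Walk along the orbit with n steps remaining. At a leading time take one step and pay `c 1`;
otherwise some k ≥ 1 has a larger value at `T^[k] x`, and jumping there is free because the skipped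
summands are nonnegative. -/
theorem le_sum_indicator_leadingSet {T : X → X} {c : ℕ → X → ℝ} (h0 : ∀ x, c 0 x ≤ 0)
    (hsub : ∀ n x, c (n + 1) x ≤ c 1 x + c n (T x)) (n : ℕ) (x : X) :
    c n x ≤ ∑ i ∈ Finset.range n,
      (leadingSet T c (n - i)).indicator (fun z => max (c 1 z) 0) (T^[i] x) := by
  have hnn : ∀ (s : Set X) z, 0 ≤ s.indicator (fun z => max (c 1 z) 0) z := fun s z =>
    Set.indicator_nonneg (fun _ _ => le_max_right _ _) z
  induction n using Nat.strong_induction_on generalizing x with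
  | _ n ih =>
    rcases n with _ | n
    · simpa using h0 x
    by_cases hx : x ∈ leadingSet T c (n + 1)
    · rw [Finset.sum_range_succ']
      have h1 := ih n (Nat.lt_succ_self n) (T x)
      have h2 : (leadingSet T c (n + 1 - 0)).indicator (fun z => max (c 1 z) 0) (T^[0] x)
          = max (c 1 x) 0 := by
        simp [Set.indicator_of_mem hx]
      rw [h2]
      simp only [Function.iterate_succ_apply, Nat.add_sub_add_right]
      linarith [hsub n x, le_max_left (c 1 x) 0]
    · simp only [leadingSet, Set.mem_ofPred_eq, not_forall, not_le] at hx
      obtain ⟨k, hk, hlt⟩ := hx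
      have hk0 : k ≠ 0 := by
        rintro rfl
        simp at hlt
      have h1 := ih (n + 1 - k) (by omega) (T^[k] x)
      refine hlt.le.trans (h1.trans ?_)
      have h2 : ∑ i ∈ Finset.range (n + 1), (leadingSet T c (n + 1 - i)).indicator
          (fun z => max (c 1 z) 0) (T^[i] x) = _ :=
        congrArg (fun m => ∑ i ∈ Finset.range m, (leadingSet T c (n + 1 - i)).indicator
          (fun z => max (c 1 z) 0) (T^[i] x)) (Nat.add_sub_cancel' hk).symm
      rw [h2, Finset.sum_range_add]
      have h3 : ∀ i, (leadingSet T c (n + 1 - (k + i))).indicator (fun z => max (c 1 z) 0)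
          (T^[k + i] x) = (leadingSet T c (n + 1 - k - i)).indicator (fun z => max (c 1 z) 0)
          (T^[i] (T^[k] x)) := fun i => by
        rw [← Function.iterate_add_apply, add_comm i k, Nat.sub_add_eq]
      simp only [h3]
      exact le_add_of_nonneg_left (Finset.sum_nonneg fun i _ => hnn _ _)

variable {T : X → X}

/-- The points at which `f` has, for every `ε > 0`, infinitely many almost leading times
of slope `B - ε`. -/
def goodSet (T : X → X) (f : ℕ → X → ℝ) (B : ℝ) : Set X :=
  {x | ∀ ε > 0, ∃ K : ℕ, ∀ N : ℕ, ∃ n ≥ N, ∀ k, K ≤ k → k ≤ n →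
    f (n - k) (T^[k] x) + (B - ε) * k ≤ f n x}

/-- Restricting to ε = 1/(m+1) makes every quantifier countable, which gives measurability. -/
theorem goodSet_eq_iInter (T : X → X) (f : ℕ → X → ℝ) (B : ℝ) :
    goodSet T f B = ⋂ m : ℕ, ⋃ K : ℕ, ⋂ N : ℕ, ⋃ n : ℕ, ⋃ (_ : n ≥ N), ⋂ k : ℕ, ⋂ (_ : K ≤ k),
      ⋂ (_ : k ≤ n), {x | f (n - k) (T^[k] x) + (B - 1 / ((m : ℝ) + 1)) * k ≤ f n x} := by
  ext x
  simp only [goodSet, Set.mem_ofPred_eq, Set.mem_iInter, Set.mem_iUnion, exists_prop]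
  refine ⟨fun h m => h _ Nat.one_div_pos_of_nat, fun h ε hε => ?_⟩
  obtain ⟨m, hm⟩ := exists_nat_one_div_lt hε
  obtain ⟨K, hK⟩ := h m
  refine ⟨K, fun N => ?_⟩
  obtain ⟨n, hn, h'⟩ := hK N
  refine ⟨n, hn, fun k h1 h2 => (add_le_add_right ?_ _).trans (h' k h1 h2)⟩
  exact mul_le_mul_of_nonneg_right (by linarith) (Nat.cast_nonneg k)

/-- Moving from x to Tx costs only the constant `f 1 x - (B - ε / 2)`, which the spare slope ε/2
absorbs once k is large. The threshold K in `goodSet` exists for this. -/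
theorem goodSet_subset_preimage {f : ℕ → X → ℝ}
    (hsub : ∀ n x, f (n + 1) x ≤ f 1 x + f n (T x)) (B : ℝ) :
    goodSet T f B ⊆ T ⁻¹' goodSet T f B := by
  intro x hx ε hε
  obtain ⟨K, hK⟩ := hx (ε / 2) (by positivity)
  obtain ⟨K', hK'⟩ := exists_nat_ge ((f 1 x - (B - ε / 2)) / (ε / 2))
  refine ⟨max K K', fun N => ?_⟩
  obtain ⟨n, hn, h⟩ := hK (N + 1)
  obtain ⟨n, rfl⟩ : ∃ m, n = m + 1 := ⟨n - 1, by omega⟩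
  refine ⟨n, by omega, fun k h1 h2 => ?_⟩
  have h3 := h (k + 1) (by omega) (by omega)
  rw [Nat.add_sub_add_right, Function.iterate_succ_apply] at h3
  have h4 : (K' : ℝ) ≤ k := by exact_mod_cast (le_max_right K K').trans h1
  rw [div_le_iff₀ (by positivity)] at hK'
  have h5 : (K' : ℝ) * (ε / 2) ≤ k * (ε / 2) := by gcongr
  push_cast at h3
  nlinarith [hsub n x]

/-- The lower bound in Kingman's subadditive ergodic theorem, at good points. -/
theorem eventually_le_of_mem_goodSet {f : ℕ → X → ℝ}
    (hsub : ∀ n m x, f (n + m) x ≤ f n x + f m (T^[n] x)) {A : ℝ} {x : X}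
    (hx : x ∈ goodSet T f A) {ε : ℝ} (hε : 0 < ε) : ∀ᶠ n : ℕ in atTop, (A - ε) * n ≤ f n x := by
  obtain ⟨K, hK⟩ := hx ε hε
  filter_upwards [eventually_ge_atTop K] with k hk
  obtain ⟨n, hn, h⟩ := hK k
  have h1 := h k hk hn
  have h2 := hsub k (n - k) x
  rw [Nat.add_sub_cancel' hn] at h2
  linarith

/-- The summands on the left are the orbit segments starting at 0, …, M-1 and all ending at n+M.
Cutting a block of length M off the longest one at each step averages over all phases, so the
Birkhoff sum is for T and ergodicity of `T^[M]` is never needed. -/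
theorem sum_iterate_le {f : ℕ → X → ℝ}
    (hsub : ∀ n m x, f (n + m) x ≤ f n x + f m (T^[n] x)) (M n : ℕ) (x : X) :
    ∑ j ∈ Finset.range M, f (n + (M - j)) (T^[j] x) ≤
      birkhoffSum T (f M) n x + ∑ j ∈ Finset.range M, f (M - j) (T^[j] (T^[n] x)) := by
  induction n generalizing x with
  | zero => simp
  | succ n ih =>
    rw [birkhoffSum_succ', Function.iterate_succ_apply]
    have h1 := ih (T x)
    have h2 : ∑ j ∈ Finset.range M, f (n + 1 + (M - j)) (T^[j] x) + f (n + 1) (T^[M] x) =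
        ∑ j ∈ Finset.range M, f (n + (M - j)) (T^[j] (T x)) + f (n + 1 + M) x := by
      have h3 := Finset.sum_range_succ (fun j => f (n + 1 + (M - j)) (T^[j] x)) M
      rw [Finset.sum_range_succ'] at h3
      simp only [Nat.sub_self, add_zero, Nat.sub_zero, Function.iterate_zero, id_eq] at h3
      rw [← h3]
      congr 1
      refine Finset.sum_congr rfl fun j hj => ?_
      rw [Finset.mem_range] at hj
      rw [Function.iterate_succ_apply, show n + 1 + (M - (j + 1)) = n + (M - j) by omega]
    have h4 := hsub M (n + 1) x
    rw [add_comm M (n + 1)] at h4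
    linarith

variable [MeasurableSpace X] {μ : Measure X}

theorem integral_comp_measurePreserving {φ : X → X} (hφ : MeasurePreserving φ μ μ) {g : X → ℝ}
    (hg : AEStronglyMeasurable g μ) : ∫ x, g (φ x) ∂μ = ∫ x, g x ∂μ := by
  conv_rhs => rw [← hφ.map_eq]
  rw [integral_map hφ.aemeasurable]
  rwa [hφ.map_eq]

theorem nullMeasurableSet_leadingSet {c : ℕ → X → ℝ} (hT : MeasurePreserving T μ μ)
    (hc : ∀ n, AEMeasurable (c n) μ) (n : ℕ) : NullMeasurableSet (leadingSet T c n) μ := by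
  have : leadingSet T c n = ⋂ k, ⋂ (_ : k ≤ n), {x | c (n - k) (T^[k] x) ≤ c n x} := by
    ext; simp [leadingSet]
  rw [this]
  exact .iInter fun k => .iInter fun _ => nullMeasurableSet_le
    ((hc (n - k)).comp_quasiMeasurePreserving (hT.iterate k).quasiMeasurePreserving) (hc n)

/-- A subadditive sequence of positive drift has infinitely many leading times on a set of positive
measure. -/
theorem measure_frequently_leadingSet_ne_zero {c : ℕ → X → ℝ} (hT : MeasurePreserving T μ μ)
    (hc : ∀ n, Integrable (c n) μ) (h0 : ∀ x, c 0 x ≤ 0)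
    (hsub : ∀ n x, c (n + 1) x ≤ c 1 x + c n (T x)) {ε : ℝ} (hε : 0 < ε)
    (hlow : ∀ n : ℕ, ε * n ≤ ∫ x, c n x ∂μ) :
    μ {x | ∃ᶠ n in atTop, x ∈ leadingSet T c n} ≠ 0 := by
  intro hz
  set g : X → ℝ := fun z => max (c 1 z) 0
  have hg : Integrable g μ := (hc 1).pos_part
  have hL := nullMeasurableSet_leadingSet hT (fun n => (hc n).aemeasurable)
  have hae : ∀ᵐ x ∂μ, ∀ᶠ n in atTop, x ∉ leadingSet T c n := by
    rw [ae_iff]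
    exact hz
  -- If leading times were almost surely finite in number, these integrals would vanish in the
  -- limit; integrating the pointwise bound then puts `∫ c n / n` below their Cesàro means, against
  -- ε > 0.
  have hlim : Tendsto (fun n => ∫ x, (leadingSet T c n).indicator g x ∂μ) atTop (𝓝 0) := by
    have := tendsto_integral_of_dominated_convergence (μ := μ) (f := fun _ => (0 : ℝ))
      (F := fun n x => (leadingSet T c n).indicator g x) g
      (fun n => hg.aestronglyMeasurable.indicator₀ (hL n)) hg
      (fun n => Eventually.of_forall fun x => by
        rw [Real.norm_of_nonneg (Set.indicator_nonneg (fun _ _ => le_max_right _ _) x)]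
        exact Set.indicator_le_self' (fun _ _ => le_max_right _ _) x)
      (hae.mono fun x hx => tendsto_const_nhds.congr' (hx.mono fun n hn => by
        exact (Set.indicator_of_notMem hn g).symm))
    simpa using this
  have hces := ((tendsto_add_atTop_iff_nat 1).2 hlim).cesaro
  have hint : ∀ n i, Integrable (fun x => (leadingSet T c n).indicator g (T^[i] x)) μ :=
    fun n i => (hT.iterate i).integrable_comp_of_integrable (hg.indicator₀ (hL n))
  have hbound : ∀ n : ℕ, ∫ x, c n x ∂μ ≤
      ∑ i ∈ Finset.range n, ∫ x, (leadingSet T c (i + 1)).indicator g x ∂μ := fun n => by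
    calc ∫ x, c n x ∂μ ≤ ∫ x, ∑ i ∈ Finset.range n,
          (leadingSet T c (n - i)).indicator g (T^[i] x) ∂μ :=
          integral_mono (hc n) (integrable_finsetSum _ fun i _ => hint _ _)
            fun x => le_sum_indicator_leadingSet h0 hsub n x
      _ = ∑ i ∈ Finset.range n, ∫ x, (leadingSet T c (n - i)).indicator g (T^[i] x) ∂μ :=
          integral_finsetSum _ fun i _ => hint _ _
      _ = ∑ i ∈ Finset.range n, ∫ x, (leadingSet T c (n - i)).indicator g x ∂μ := by
          exact Finset.sum_congr rfl fun i _ => integral_comp_measurePreserving (hT.iterate i)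
            (hg.indicator₀ (hL _)).aestronglyMeasurable
      _ = ∑ i ∈ Finset.range n, ∫ x, (leadingSet T c (i + 1)).indicator g x ∂μ := by
          rw [← Finset.sum_range_reflect]
          refine Finset.sum_congr rfl fun i hi => ?_
          rw [Finset.mem_range] at hi
          rw [show n - (n - 1 - i) = i + 1 by omega]
  refine absurd (ge_of_tendsto hces (b := ε) ?_) (not_le.2 hε)
  filter_upwards [eventually_gt_atTop 0] with n hn
  have hn' : (0 : ℝ) < n := Nat.cast_pos.2 hn
  rw [inv_mul_eq_div, le_div_iff₀ hn']
  exact (hlow n).trans (hbound n)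

theorem nullMeasurableSet_goodSet {f : ℕ → X → ℝ} (hT : MeasurePreserving T μ μ)
    (hf : ∀ n, AEMeasurable (f n) μ) (B : ℝ) : NullMeasurableSet (goodSet T f B) μ := by
  rw [goodSet_eq_iInter]
  exact .iInter fun m => .iUnion fun K => .iInter fun N => .iUnion fun n => .iUnion fun _ =>
    .iInter fun k => .iInter fun _ => .iInter fun _ => nullMeasurableSet_le
      (((hf (n - k)).comp_quasiMeasurePreserving
        (hT.iterate k).quasiMeasurePreserving).add_const _) (hf n)

variable [IsProbabilityMeasure μ]

theorem ae_mem_goodSet_of_lt {f : ℕ → X → ℝ} (hT : Ergodic T μ)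
    (hf : ∀ n, Integrable (f n) μ) (h0 : ∀ x, f 0 x ≤ 0)
    (hsub : ∀ n x, f (n + 1) x ≤ f 1 x + f n (T x)) {A B : ℝ} (hBA : B < A)
    (hlow : ∀ n : ℕ, A * n ≤ ∫ x, f n x ∂μ) : ∀ᵐ x ∂μ, x ∈ goodSet T f B := by
  have hpos := measure_frequently_leadingSet_ne_zero (c := fun n x => f n x - B * n)
    hT.toMeasurePreserving (fun n => (hf n).sub (integrable_const _)) (fun x => by simpa using h0 x)
    (fun n x => by
      have := hsub n x
      push_cast
      linarith) (sub_pos.2 hBA) (fun n => by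
      rw [integral_sub (hf n) (integrable_const _)]
      simp only [integral_const, probReal_univ, one_smul]
      linarith [hlow n])
  have hss : {x | ∃ᶠ n in atTop, x ∈ leadingSet T (fun n x => f n x - B * n) n} ⊆
      goodSet T f B := by
    intro x hx ε hε
    refine ⟨0, fun N => ?_⟩
    obtain ⟨n, hn, h⟩ := frequently_atTop.1 hx N
    refine ⟨n, hn, fun k _ hk => ?_⟩
    have h1 := h k hk
    simp only [Nat.cast_sub hk] at h1
    nlinarith [mul_nonneg hε.le (Nat.cast_nonneg k : (0 : ℝ) ≤ k)]
  have hne : μ (goodSet T f B) ≠ 0 := fun h => hpos (measure_mono_null hss h)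
  -- A set of positive measure contained in its own preimage has full measure by ergodicity.
  rcases hT.ae_empty_or_univ_of_ae_le_preimage'
    (nullMeasurableSet_goodSet hT.toMeasurePreserving (fun n => (hf n).aemeasurable) B)
    (LE.le.eventuallyLE (goodSet_subset_preimage hsub B)) (measure_ne_top _ _)
    with h | h
  · exact absurd (ae_eq_empty.1 h) hne
  · exact eventuallyEq_univ.1 h

/-- A subadditive sequence of drift at least `A` has, almost everywhere and for every `ε > 0`,
infinitely many almost leading times of slope `A - ε`. -/
theorem ae_mem_goodSet {f : ℕ → X → ℝ} (hT : Ergodic T μ)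
    (hf : ∀ n, Integrable (f n) μ) (h0 : ∀ x, f 0 x ≤ 0)
    (hsub : ∀ n x, f (n + 1) x ≤ f 1 x + f n (T x)) {A : ℝ}
    (hlow : ∀ n : ℕ, A * n ≤ ∫ x, f n x ∂μ) : ∀ᵐ x ∂μ, x ∈ goodSet T f A := by
  have h : ∀ᵐ x ∂μ, ∀ m : ℕ, x ∈ goodSet T f (A - 1 / ((m : ℝ) + 1)) :=
    ae_all_iff.2 fun m => ae_mem_goodSet_of_lt hT hf h0 hsub
      (sub_lt_self _ Nat.one_div_pos_of_nat) hlow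
  filter_upwards [h] with x hx ε hε
  obtain ⟨m, hm⟩ := exists_nat_one_div_lt (half_pos hε)
  obtain ⟨K, hK⟩ := hx m (ε / 2) (half_pos hε)
  refine ⟨K, fun N => ?_⟩
  obtain ⟨n, hn, h'⟩ := hK N
  refine ⟨n, hn, fun k h1 h2 => (add_le_add_right ?_ _).trans (h' k h1 h2)⟩
  exact mul_le_mul_of_nonneg_right (by linarith) (Nat.cast_nonneg k)

/-- **Birkhoff's ergodic theorem**, for an ergodic transformation. -/
theorem tendsto_birkhoffSum_div {g : X → ℝ} (hT : Ergodic T μ) (hg : Integrable g μ) :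
    ∀ᵐ x ∂μ, Tendsto (fun n : ℕ => birkhoffSum T g n x / n) atTop (𝓝 (∫ x, g x ∂μ)) := by
  -- Birkhoff sums are additive, so the lower Kingman bound applies to both g and -g.
  have key : ∀ h : X → ℝ, Integrable h μ → ∀ᵐ x ∂μ, ∀ ε > 0, ∀ᶠ n : ℕ in atTop,
      ((∫ x, h x ∂μ) - ε) * n ≤ birkhoffSum T h n x := by
    intro h hh
    have hi : ∀ i, Integrable (fun x => h (T^[i] x)) μ := fun i =>
      (hT.toMeasurePreserving.iterate i).integrable_comp_of_integrable hh
    have hI : ∀ i, ∫ x, h (T^[i] x) ∂μ = ∫ x, h x ∂μ := fun i =>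
      integral_comp_measurePreserving (hT.toMeasurePreserving.iterate i) hh.aestronglyMeasurable
    have hx := ae_mem_goodSet (f := fun n x => birkhoffSum T h n x) (A := ∫ x, h x ∂μ) hT
      (fun n => integrable_finsetSum _ fun i _ => hi i) (fun x => by simp)
      (fun n x => by simp [birkhoffSum_succ' T h n x]) (fun n => by
        simp only [birkhoffSum]
        rw [integral_finsetSum _ fun i _ => hi i]
        simp [hI, mul_comm])
    filter_upwards [hx] with x hx ε hε
    exact eventually_le_of_mem_goodSet (T := T)
      (fun n m x => (birkhoffSum_add T h n m x).le) hx hε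
  filter_upwards [key g hg, key (-g) hg.neg] with x h1 h2
  rw [Metric.tendsto_nhds]
  intro ε hε
  filter_upwards [h1 (ε / 2) (half_pos hε), h2 (ε / 2) (half_pos hε), eventually_gt_atTop 0]
    with n h3 h4 hn
  have hn' : (0 : ℝ) < n := Nat.cast_pos.2 hn
  have h5 : birkhoffSum T (-g) n x = - birkhoffSum T g n x := by simp [birkhoffSum]
  have h6 : ∫ x, (-g) x ∂μ = - ∫ x, g x ∂μ := integral_neg g
  rw [h5, h6] at h4
  rw [Real.dist_eq, abs_lt]
  constructor
  · rw [lt_sub_iff_add_lt, lt_div_iff₀ hn']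
    nlinarith
  · rw [sub_lt_iff_lt_add, div_lt_iff₀ hn']
    nlinarith

/-- `g (T^[n] x)` is the difference of consecutive Birkhoff sums, whose averages have the same
limit. -/
theorem ae_tendsto_comp_iterate_div {g : X → ℝ} (hT : Ergodic T μ) (hg : Integrable g μ) :
    ∀ᵐ x ∂μ, Tendsto (fun n : ℕ => g (T^[n] x) / n) atTop (𝓝 0) := by
  filter_upwards [tendsto_birkhoffSum_div hT hg] with x hx
  have h1 : Tendsto (fun n : ℕ => ((n : ℝ) + 1) / n) atTop (𝓝 1) := by
    have : Tendsto (fun n : ℕ => 1 + 1 / (n : ℝ)) atTop (𝓝 (1 + 0)) :=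
      tendsto_const_nhds.add tendsto_one_div_atTop_nhds_zero_nat
    rw [add_zero] at this
    refine this.congr' ?_
    filter_upwards [eventually_gt_atTop 0] with n hn
    have : (n : ℝ) ≠ 0 := by positivity
    field_simp
  have h2 := (((tendsto_add_atTop_iff_nat 1).2 hx).mul h1).sub hx
  rw [mul_one, sub_self] at h2
  refine h2.congr' ?_
  filter_upwards [eventually_gt_atTop 0] with n hn
  have : (n : ℝ) ≠ 0 := by positivity
  rw [birkhoffSum_succ]
  push_cast
  field_simp
  ring

/-- The upper bound in Kingman's subadditive ergodic theorem. -/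
theorem ae_eventually_le_of_subadditive {f : ℕ → X → ℝ} (hT : Ergodic T μ)
    (hf : ∀ n, Integrable (f n) μ)
    (hsub : ∀ n m x, f (n + m) x ≤ f n x + f m (T^[n] x)) {M : ℕ} (hM : 0 < M) {B : ℝ}
    (hB : ∫ x, f M x ∂μ < B * M) : ∀ᵐ x ∂μ, ∀ᶠ n : ℕ in atTop, f n x ≤ B * n := by
  set ψ : X → ℝ := fun z => ∑ j ∈ Finset.range M, f (M - j) (T^[j] z)
  have hψ : Integrable ψ μ := integrable_finsetSum _ fun j _ =>
    (hT.toMeasurePreserving.iterate j).integrable_comp_of_integrable (hf _)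
  filter_upwards [tendsto_birkhoffSum_div hT (hf M), ae_tendsto_comp_iterate_div hT hψ]
    with x h1 h2
  -- The term `B * M * M` turns the target `B * M * (n + M)` into `B * M * n`.
  have hconst : Tendsto (fun n : ℕ => (∑ j ∈ Finset.range M, f j x - B * M * M) / (n : ℝ)) atTop
      (𝓝 0) := tendsto_const_div_atTop_nhds_zero_nat _
  have hlim := (h1.add h2).add hconst
  rw [add_zero, add_zero] at hlim
  have hev : ∀ᶠ n : ℕ in atTop, f (n + M) x ≤ B * ((n + M : ℕ) : ℝ) := by
    filter_upwards [hlim.eventually (gt_mem_nhds hB), eventually_gt_atTop 0] with n hn hn0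
    have hn' : (0 : ℝ) < n := Nat.cast_pos.2 hn0
    have hM' : (0 : ℝ) < M := Nat.cast_pos.2 hM
    rw [← add_div, ← add_div, div_lt_iff₀ hn'] at hn
    have h3 : M * f (n + M) x ≤ ∑ j ∈ Finset.range M, f j x +
        ∑ j ∈ Finset.range M, f (n + (M - j)) (T^[j] x) := by
      rw [← Finset.sum_add_distrib]
      have : (M : ℝ) * f (n + M) x = ∑ j ∈ Finset.range M, f (n + M) x := by simp
      rw [this]
      refine Finset.sum_le_sum fun j hj => ?_
      rw [Finset.mem_range] at hj
      have := hsub j (n + (M - j)) x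
      rwa [show j + (n + (M - j)) = n + M by omega] at this
    have h4 := sum_iterate_le hsub M n x
    have h5 : (M : ℝ) * f (n + M) x ≤ M * (B * (n + M)) := by
      simp only [ψ] at hn
      nlinarith
    push_cast
    exact le_of_mul_le_mul_left h5 hM'
  obtain ⟨N, hN⟩ := eventually_atTop.1 hev
  filter_upwards [eventually_ge_atTop (N + M)] with n hn
  have := hN (n - M) (by omega)
  rwa [Nat.sub_add_cancel (by omega)] at this

end Ergodic

/-! ### Convexity: almost geodesic sequences follow a unique ray. -/

section Geometry

variable {Y : Type*} [MetricSpace Y]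

theorem IsGeodesicSpace.exists_path (h : IsGeodesicSpace Y) (x y : Y) :
    ∃ γ : ℝ → Y, IsGeodesicPath (dist x y) γ ∧ γ 0 = x ∧ γ (dist x y) = y := by
  obtain ⟨l, γ, hγ, h0, h1⟩ := h x y
  have hl : dist x y = l := by
    rw [← h0, ← h1, hγ.2 0 ⟨le_rfl, hγ.1⟩ l ⟨hγ.1, le_rfl⟩, zero_sub, abs_neg, abs_of_nonneg hγ.1]
  exact ⟨γ, hl ▸ hγ, h0, hl ▸ h1⟩

theorem IsGeodesicPath.mono {l l' : ℝ} {γ : ℝ → Y} (h : IsGeodesicPath l γ) (h0 : 0 ≤ l')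
    (hl : l' ≤ l) : IsGeodesicPath l' γ :=
  ⟨h0, fun s hs t ht => h.2 s ⟨hs.1, hs.2.trans hl⟩ t ⟨ht.1, ht.2.trans hl⟩⟩

theorem IsGeodesicRay.isGeodesicPath {a : Y} {γ : ℝ≥0 → Y} (h : IsGeodesicRay a γ) {l : ℝ}
    (hl : 0 ≤ l) : IsGeodesicPath l fun s => γ s.toNNReal :=
  ⟨hl, fun s hs t ht => by
    rw [h.1.dist_eq, NNReal.dist_eq, Real.coe_toNNReal _ hs.1, Real.coe_toNNReal _ ht.1]⟩

/-- In a Busemann convex geodesic space, distance functions are convex along midpoints. -/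
theorem exists_midpoint_dist_le (hg : IsGeodesicSpace Y) (hb : IsBusemannConvex Y) (x y : Y) :
    ∃ m, IsMidpoint x y m ∧ ∀ z, dist m z ≤ (dist x z + dist y z) / 2 := by
  obtain ⟨γ, hγ, h0, h1⟩ := hg.exists_path x y
  have hd : 0 ≤ dist x y := dist_nonneg
  have hmem : 1 / 2 * dist x y ∈ Set.Icc 0 (dist x y) := ⟨by positivity, by linarith⟩
  refine ⟨γ (1 / 2 * dist x y), ⟨?_, ?_⟩, fun z => ?_⟩
  · have h2 := hγ.2 0 ⟨le_rfl, hd⟩ _ hmem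
    rw [h0, zero_sub, abs_neg, abs_of_nonneg hmem.1] at h2
    rw [h2]
    ring
  · have h2 := hγ.2 _ ⟨hd, le_rfl⟩ _ hmem
    rw [h1, abs_of_nonneg (by linarith)] at h2
    rw [h2]
    ring
  · obtain ⟨γ', hγ', h0', h1'⟩ := hg.exists_path x z
    have hd' : 0 ≤ dist x z := dist_nonneg
    have hmem' : 1 / 2 * dist x z ∈ Set.Icc 0 (dist x z) := ⟨by positivity, by linarith⟩
    have h2 := hb _ _ γ γ' hγ hγ' (h0.trans h0'.symm) (1 / 2) ⟨by norm_num, by norm_num⟩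
    rw [h1, h1'] at h2
    have h3 := hγ'.2 _ hmem' _ ⟨hd', le_rfl⟩
    rw [h1', abs_sub_comm, abs_of_nonneg (by linarith)] at h3
    linarith [dist_triangle (γ (1 / 2 * dist x y)) (γ' (1 / 2 * dist x z)) z]

/-- A real c strictly between 0 and the infimum serves every radius beyond s at once. -/
theorem HasLargeScaleModulus.exists_dist_midpoint_le (h : HasLargeScaleModulus Y) (a : Y) {ε : ℝ}
    (hε : 0 < ε) : ∃ s > 0, ∃ c > 0, ∀ r ≥ s, ∀ x y m : Y, dist a x ≤ r → dist a y ≤ r →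
      ε * r ≤ dist x y → IsMidpoint x y m → dist a m ≤ (1 - c) * r := by
  obtain ⟨s, hs, hpos⟩ := h a ε hε
  obtain ⟨c, hc0, hc⟩ := EReal.lt_iff_exists_real_btwn.1 hpos
  refine ⟨s, hs, c, by exact_mod_cast hc0, fun r hr x y m hx hy hxy hm => ?_⟩
  have h1 : (c : EReal) ≤ ((1 - dist a m / r : ℝ) : EReal) :=
    hc.le.trans ((iInf₂_le r hr).trans (sInf_le ⟨x, y, m, hx, hy, hxy, hm, rfl⟩))
  rw [EReal.coe_le_coe_iff, le_sub_comm, div_le_iff₀ (hs.trans_le hr)] at h1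
  exact h1

/-- A point `z` lying almost on a geodesic from `a` to `w` is close to the point `p` of that
geodesic at the same distance from `a`. -/
theorem exists_dist_le_of_almost_geodesic (hg : IsGeodesicSpace Y) (hb : IsBusemannConvex Y)
    (hm : HasLargeScaleModulus Y) (a : Y) {A η δ : ℝ} (hA : 0 < A) (hη : 0 < η) (hδ : 0 < δ) :
    ∃ ε > 0, ε ≤ δ ∧ ∃ K : ℝ, ∀ k ≥ K, ∀ z w p : Y, dist a z ≤ (A + ε) * k →
      dist z w ≤ dist a w - (A - ε) * k → dist a p ≤ (A - ε) * k →
      dist p w ≤ dist a w - (A - ε) * k → dist z p ≤ η * k := by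
  obtain ⟨s, hs, c, hc, h⟩ := hm.exists_dist_midpoint_le a (ε := η / (2 * A)) (by positivity)
  -- ε ≤ A keeps the radius (A+ε)k below 2Ak; ε ≤ cA/4 contradicts A - ε ≤ (1-c)(A+ε).
  set ε := min δ (min A (c * A / 4))
  have hεδ : ε ≤ δ := min_le_left _ _
  have hεA : ε ≤ A := (min_le_right _ _).trans (min_le_left _ _)
  have hεc : ε ≤ c * A / 4 := (min_le_right _ _).trans (min_le_right _ _)
  have hε : 0 < ε := lt_min hδ (lt_min hA (by positivity))
  refine ⟨ε, hε, hεδ, max 1 (s / A), fun k hk z w p hz hzw hp hpw => ?_⟩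
  have hk0 : 0 < k := one_pos.trans_le ((le_max_left _ _).trans hk)
  have hks : s ≤ A * k := by
    have := (le_max_right _ _).trans hk
    rwa [div_le_iff₀ hA, mul_comm] at this
  by_contra! hcon
  -- If z and p were far apart, their midpoint would be markedly closer to a but no farther from w
  -- than allowed for z and p, a shortcut violating the triangle inequality from a to w.
  obtain ⟨m, hmid, hmw⟩ := exists_midpoint_dist_le hg hb z p
  have h1 : η / (2 * A) * ((A + ε) * k) ≤ dist z p := by
    refine le_trans ?_ hcon.le
    rw [div_mul_eq_mul_div, div_le_iff₀ (by positivity)]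
    have : (A + ε) * k ≤ k * (2 * A) := by nlinarith
    calc η * ((A + ε) * k) ≤ η * (k * (2 * A)) := by gcongr
      _ = η * k * (2 * A) := by ring
  have hεk := mul_pos hε hk0
  have h2 := h ((A + ε) * k) (by nlinarith) z p m hz (by nlinarith) h1 hmid
  have h3 := hmw w
  have h4 := dist_triangle a m w
  have h5 : (A - ε) * k ≤ (1 - c) * ((A + ε) * k) := by linarith
  have h6 : A - ε ≤ (1 - c) * (A + ε) := by
    rw [← mul_assoc] at h5
    exact le_of_mul_le_mul_right h5 hk0
  nlinarith [mul_pos hc hA, mul_pos hc hε]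

/-- Geodesics from `a` to the points of a sequence that progresses at speed `A` almost along
geodesics become close to each other. -/
theorem exists_dist_path_le (hg : IsGeodesicSpace Y) (hb : IsBusemannConvex Y)
    (hm : HasLargeScaleModulus Y) (a : Y) {A : ℝ} (hA : 0 < A) {u : ℕ → Y}
    (hu : ∀ ε > 0, ∀ᶠ n : ℕ in atTop, |dist a (u n) - A * n| ≤ ε * n)
    (hgood : ∀ ε > 0, ∃ K : ℕ, ∀ N : ℕ, ∃ n ≥ N, ∀ k, K ≤ k → k ≤ n →
      dist (u k) (u n) + (A - ε) * k ≤ dist a (u n))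
    {σ : ℕ → ℝ → Y} (hσ : ∀ n, IsGeodesicPath (dist a (u n)) (σ n)) (hσ0 : ∀ n, σ n 0 = a)
    (hσ1 : ∀ n, σ n (dist a (u n)) = u n) {η : ℝ} (hη : 0 < η) :
    ∃ K : ℕ, ∀ k ≥ K, ∀ k' ≥ K, ∀ t, 0 ≤ t → t ≤ dist a (u k) → t ≤ dist a (u k') →
      dist (σ k t) (σ k' t) ≤ η * t := by
  -- The total error is 3η'k · t/l with l ≥ Ak/2, which is η/2 · t.
  set η' := η * A / 12
  have hη' : 0 < η' := by positivity
  obtain ⟨ε, hε, hεδ, K₁, h₁⟩ := exists_dist_le_of_almost_geodesic hg hb hm a hA hη'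
    (δ := min η' (A / 2)) (by positivity)
  have hεη : ε ≤ η' := hεδ.trans (min_le_left _ _)
  have hεA : ε ≤ A / 2 := hεδ.trans (min_le_right _ _)
  obtain ⟨K₂, h₂⟩ := eventually_atTop.1 (hu ε hε)
  obtain ⟨K₃, h₃⟩ := hgood ε hε
  obtain ⟨K₄, h₄⟩ := exists_nat_ge K₁
  have hlarge : ∀ R : ℝ, ∃ N : ℕ, ∀ n ≥ N, R ≤ dist a (u n) := fun R => by
    obtain ⟨N, hN⟩ := exists_nat_ge (R / (A / 2))
    refine ⟨max N K₂, fun n hn => ?_⟩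
    have h5 := abs_le.1 (h₂ n ((le_max_right _ _).trans hn))
    have h6 : (N : ℝ) ≤ n := by exact_mod_cast (le_max_left _ _).trans hn
    rw [div_le_iff₀ (by positivity)] at hN
    have h7 : (0 : ℝ) ≤ n := n.cast_nonneg
    nlinarith
  set K := max (max K₂ K₃) (max K₄ 1)
  have key : ∀ k ≥ K, ∀ n, (∀ j, K₃ ≤ j → j ≤ n →
      dist (u j) (u n) + (A - ε) * j ≤ dist a (u n)) → k ≤ n → dist a (u k) ≤ dist a (u n) →
      ∀ t, 0 ≤ t → t ≤ dist a (u k) → dist (σ k t) (σ n t) ≤ η / 2 * t := by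
    intro k hk n hn hkn hle t ht0 ht
    have hkK₁ : K₁ ≤ k := h₄.trans (by
      exact_mod_cast ((le_max_left _ _).trans (le_max_right _ _)).trans hk)
    have hk1 : (1 : ℝ) ≤ k := by
      exact_mod_cast ((le_max_right _ _).trans (le_max_right _ _)).trans hk
    have hk2 := abs_le.1 (h₂ k (((le_max_left _ _).trans (le_max_left _ _)).trans hk))
    have hk3 := hn k (((le_max_right _ _).trans (le_max_left _ _)).trans hk) hkn
    set b := (A - ε) * (k : ℝ)
    set l := dist a (u k)
    have hb0 : 0 ≤ b := mul_nonneg (by linarith) (by linarith)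
    have hbn : b ≤ dist a (u n) := by linarith [dist_nonneg (x := u k) (y := u n)]
    have hbA : b = A * k - ε * k := by simp only [b]; ring
    have hlA : A / 2 * k ≤ l := by nlinarith
    have hl0 : 0 < l := by nlinarith
    have hp1 : dist a (σ n b) = b := by
      conv_lhs => rw [← hσ0 n]
      rw [(hσ n).2 0 ⟨le_rfl, dist_nonneg⟩ b ⟨hb0, hbn⟩, zero_sub, abs_neg, abs_of_nonneg hb0]
    have hp2 : dist (σ n b) (u n) = dist a (u n) - b := by
      conv_lhs => rw [← hσ1 n]
      rw [(hσ n).2 b ⟨hb0, hbn⟩ _ ⟨dist_nonneg, le_rfl⟩, abs_sub_comm,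
        abs_of_nonneg (by linarith)]
    have hclose : dist (u k) (σ n b) ≤ η' * k :=
      h₁ k hkK₁ (u k) (u n) (σ n b) (by linarith) (by linarith) hp1.le hp2.le
    have hs : t / l ∈ Set.Icc (0 : ℝ) 1 := ⟨by positivity, (div_le_one hl0).2 ht⟩
    have hbus := hb l b (σ k) (σ n) (hσ k) ((hσ n).mono hb0 hbn)
      ((hσ0 k).trans (hσ0 n).symm) (t / l) hs
    have htl : t / l * l = t := div_mul_cancel₀ _ hl0.ne'
    rw [htl, hσ1 k] at hbus
    have hsb : t / l * b ∈ Set.Icc 0 (dist a (u n)) :=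
      ⟨mul_nonneg hs.1 hb0, (mul_le_of_le_one_left hb0 hs.2).trans hbn⟩
    have hshift : dist (σ n (t / l * b)) (σ n t) ≤ t / l * (2 * (η' * k)) := by
      rw [(hσ n).2 _ hsb t ⟨ht0, ht.trans hle⟩]
      have hdiff : t / l * b - t = t / l * (b - l) := by rw [mul_sub, htl]
      rw [hdiff, abs_mul, abs_of_nonneg hs.1]
      refine mul_le_mul_of_nonneg_left (abs_le.2 ?_) hs.1
      have : ε * k ≤ η' * k := mul_le_mul_of_nonneg_right hεη (by linarith)
      constructor <;> nlinarith
    have htot : dist (σ k t) (σ n t) ≤ t / l * (3 * (η' * k)) := by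
      have := dist_triangle (σ k t) (σ n (t / l * b)) (σ n t)
      have h6 := mul_le_mul_of_nonneg_left hclose hs.1
      nlinarith
    refine htot.trans ?_
    rw [div_mul_eq_mul_div, div_le_iff₀ hl0]
    have : 3 * (η' * k) ≤ η / 2 * l := by
      simp only [η']
      nlinarith
    nlinarith
  refine ⟨K, fun k hk k' hk' t ht0 ht ht' => ?_⟩
  -- Both geodesics are compared with the one to `u n`, for one good time n beyond k and k'.
  obtain ⟨N, hN⟩ := hlarge (max (dist a (u k)) (dist a (u k')))
  obtain ⟨n, hn, hgn⟩ := h₃ (max N (max k k'))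
  have hnN := hN n ((le_max_left _ _).trans hn)
  have hkk := (le_max_right _ _).trans hn
  have e1 := key k hk n hgn ((le_max_left _ _).trans hkk) ((le_max_left _ _).trans hnN) t ht0 ht
  have e2 := key k' hk' n hgn ((le_max_right _ _).trans hkk) ((le_max_right _ _).trans hnN)
    t ht0 ht'
  rw [dist_comm] at e2
  linarith [dist_triangle (σ k t) (σ n t) (σ k' t)]

/-- The ray is the pointwise limit of the geodesics from a to `u k`. The bound ηt is used twice: at
fixed t for the Cauchy property, and at t = d(a, u_k) for tracking. -/
theorem exists_geodesicRay [CompleteSpace Y] (hg : IsGeodesicSpace Y) (hb : IsBusemannConvex Y)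
    (hm : HasLargeScaleModulus Y) (a : Y) {A : ℝ} (hA : 0 < A) {u : ℕ → Y}
    (hu : ∀ ε > 0, ∀ᶠ n : ℕ in atTop, |dist a (u n) - A * n| ≤ ε * n)
    (hgood : ∀ ε > 0, ∃ K : ℕ, ∀ N : ℕ, ∃ n ≥ N, ∀ k, K ≤ k → k ≤ n →
      dist (u k) (u n) + (A - ε) * k ≤ dist a (u n)) :
    ∃ γ : ℝ≥0 → Y, IsGeodesicRay a γ ∧ Tendsto (fun n : ℕ => (1 / (n : ℝ)) *
        dist (γ (Real.toNNReal (A * n))) (u n)) atTop (𝓝 0) := by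
  choose σ hσ hσ0 hσ1 using fun n => hg.exists_path a (u n)
  have hlarge : ∀ R : ℝ, ∀ᶠ n in atTop, R ≤ dist a (u n) := fun R => by
    have h1 : Tendsto (fun n : ℕ => A / 2 * (n : ℝ)) atTop atTop :=
      tendsto_natCast_atTop_atTop.const_mul_atTop (by positivity)
    filter_upwards [hu (A / 2) (by positivity), h1.eventually_ge_atTop R] with n h2 h3
    linarith [(abs_le.1 h2).1]
  have hpath : ∀ η > 0, ∃ K : ℕ, ∀ k ≥ K, ∀ k' ≥ K, ∀ t, 0 ≤ t → t ≤ dist a (u k) →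
      t ≤ dist a (u k') → dist (σ k t) (σ k' t) ≤ η * t := fun η hη =>
    exists_dist_path_le hg hb hm a hA hu hgood hσ hσ0 hσ1 hη
  have hlim : ∀ t : ℝ≥0, ∃ z, Tendsto (fun k => σ k t) atTop (𝓝 z) := fun t => by
    refine cauchySeq_tendsto_of_complete (Metric.cauchySeq_iff.2 fun ε hε => ?_)
    obtain ⟨K, hK⟩ := hpath (ε / (t + 1)) (by positivity)
    obtain ⟨N, hN⟩ := eventually_atTop.1 (hlarge t)
    refine ⟨max K N, fun k hk k' hk' => ?_⟩
    refine (hK k ((le_max_left _ _).trans hk) k' ((le_max_left _ _).trans hk') t t.2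
      (hN k ((le_max_right _ _).trans hk)) (hN k' ((le_max_right _ _).trans hk'))).trans_lt ?_
    rw [div_mul_eq_mul_div, div_lt_iff₀ (by positivity)]
    nlinarith
  choose γ hγ using hlim
  have hiso : Isometry γ := by
    refine Isometry.of_dist_eq fun s t => ?_
    refine tendsto_nhds_unique ((hγ s).dist (hγ t)) (tendsto_const_nhds.congr' ?_)
    filter_upwards [hlarge s, hlarge t] with k h1 h2
    rw [(hσ k).2 s ⟨s.2, h1⟩ t ⟨t.2, h2⟩, NNReal.dist_eq]
  refine ⟨γ, ⟨hiso, ?_⟩, ?_⟩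
  · refine tendsto_nhds_unique (hγ 0) (tendsto_const_nhds.congr fun k => ?_)
    rw [NNReal.coe_zero, hσ0]
  · have hray : ∀ η > 0, ∀ᶠ k in atTop,
        dist (γ (dist a (u k)).toNNReal) (u k) ≤ η * dist a (u k) := fun η hη => by
      obtain ⟨K, hK⟩ := hpath η hη
      filter_upwards [eventually_ge_atTop K] with k hk
      refine le_of_tendsto ((hγ (dist a (u k)).toNNReal).dist tendsto_const_nhds) ?_
      rw [Real.coe_toNNReal _ dist_nonneg]
      filter_upwards [eventually_ge_atTop K, hlarge (dist a (u k))] with n hn hn'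
      have := hK n hn k hk (dist a (u k)) dist_nonneg hn' le_rfl
      rwa [hσ1] at this
    rw [Metric.tendsto_nhds]
    intro ε hε
    filter_upwards [hu (ε / 4) (by positivity), hu A hA, hray (ε / (8 * A)) (by positivity),
      eventually_gt_atTop 0] with k h1 h2 h3 hk
    have hk' : (0 : ℝ) < k := Nat.cast_pos.2 hk
    have h4 : dist (γ (Real.toNNReal (A * k))) (γ (dist a (u k)).toNNReal) ≤ ε / 4 * k := by
      rw [hiso.dist_eq, NNReal.dist_eq, Real.coe_toNNReal _ (by positivity),
        Real.coe_toNNReal _ dist_nonneg, abs_sub_comm]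
      exact h1
    have h5 : ε / (8 * A) * dist a (u k) ≤ ε / 4 * k := by
      calc ε / (8 * A) * dist a (u k) ≤ ε / (8 * A) * (2 * A * k) := by
            gcongr
            linarith [(abs_le.1 h2).2]
        _ = ε / 4 * k := by
            field_simp
            ring
    have h6 := dist_triangle (γ (Real.toNNReal (A * k))) (γ (dist a (u k)).toNNReal) (u k)
    rw [Real.dist_eq, sub_zero, abs_of_nonneg (by positivity), one_div, inv_mul_eq_div,
      div_lt_iff₀ hk']
    nlinarith [mul_pos hε hk']

/-- Rays from a common origin satisfy d(γ t, γ' t) ≤ (t/An) d(γ(An), γ'(An)), and the right side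
tends to 0 since both rays follow `u`. -/
theorem geodesicRay_unique (hb : IsBusemannConvex Y) {a : Y} {A : ℝ} (hA : 0 < A) {u : ℕ → Y}
    {γ γ' : ℝ≥0 → Y} (hγ : IsGeodesicRay a γ) (hγ' : IsGeodesicRay a γ')
    (h : Tendsto (fun n : ℕ => (1 / (n : ℝ)) * dist (γ (Real.toNNReal (A * n))) (u n))
      atTop (𝓝 0))
    (h' : Tendsto (fun n : ℕ => (1 / (n : ℝ)) * dist (γ' (Real.toNNReal (A * n))) (u n))
      atTop (𝓝 0)) : γ = γ' := by
  funext t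
  rw [← dist_le_zero]
  have hlim := (h.add h').const_mul ((t : ℝ) / A)
  rw [add_zero, mul_zero] at hlim
  refine ge_of_tendsto hlim ?_
  have h1 : Tendsto (fun n : ℕ => A * (n : ℝ)) atTop atTop :=
    tendsto_natCast_atTop_atTop.const_mul_atTop hA
  filter_upwards [h1.eventually_ge_atTop t, eventually_gt_atTop 0] with n hn hn0
  have hn' : (0 : ℝ) < n := Nat.cast_pos.2 hn0
  have hAn : 0 < A * n := mul_pos hA hn'
  have h2 := hb (A * n) (A * n) _ _ (hγ.isGeodesicPath hAn.le) (hγ'.isGeodesicPath hAn.le)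
    (by simp [hγ.2, hγ'.2]) (t / (A * n)) ⟨by positivity, (div_le_one hAn).2 hn⟩
  rw [div_mul_cancel₀ _ hAn.ne', Real.toNNReal_coe] at h2
  refine h2.trans ?_
  have h3 := dist_triangle_right (γ (Real.toNNReal (A * n))) (γ' (Real.toNNReal (A * n))) (u n)
  calc (t : ℝ) / (A * n) * dist (γ (Real.toNNReal (A * n))) (γ' (Real.toNNReal (A * n)))
      ≤ t / (A * n) * (dist (γ (Real.toNNReal (A * n))) (u n) +
        dist (γ' (Real.toNNReal (A * n))) (u n)) := by gcongr
    _ = _ := by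
      field_simp

end Geometry

/-! ### Displacements of nonexpansive cocycles. -/

section Cocycle

variable {X D : Type*} [MetricSpace D] {S : Set C(D, D)} {T : X → X} {w : X → S}

theorem cocycle_add (n m : ℕ) (x : X) :
    cocycle T w (n + m) x = (cocycle T w n x).comp (cocycle T w m (T^[n] x)) := by
  induction m with
  | zero => rfl
  | succ m ih =>
    rw [← add_assoc, cocycle, ih, cocycle, ContinuousMap.comp_assoc, add_comm n m,
      Function.iterate_add_apply]

theorem IsNonexpansiveSemigroup.lipschitzWith_cocycle (hS : IsNonexpansiveSemigroup S) (n : ℕ)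
    (x : X) : LipschitzWith 1 (cocycle T w n x) := by
  induction n with
  | zero => exact LipschitzWith.id
  | succ n ih =>
    have := ih.comp (hS.1 _ (w (T^[n] x)).2)
    rwa [mul_one] at this

/-- New factors enter on the right, so the nonexpansive `a_n(x)` can be stripped from both points.
This turns good times into almost geodesic behaviour of the orbit. -/
theorem IsNonexpansiveSemigroup.dist_cocycle_add_le (hS : IsNonexpansiveSemigroup S) (y : D)
    (n m : ℕ) (x : X) : dist (cocycle T w n x y) (cocycle T w (n + m) x y) ≤
      dist y (cocycle T w m (T^[n] x) y) := by
  rw [cocycle_add]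
  have := (hS.lipschitzWith_cocycle (T := T) (w := w) n x).dist_le_mul y (cocycle T w m (T^[n] x) y)
  rwa [NNReal.coe_one, one_mul] at this

theorem IsNonexpansiveSemigroup.displacement_add_le (hS : IsNonexpansiveSemigroup S) (y : D)
    (n m : ℕ) (x : X) : dist y (cocycle T w (n + m) x y) ≤
      dist y (cocycle T w n x y) + dist y (cocycle T w m (T^[n] x) y) :=
  (dist_triangle _ _ _).trans (add_le_add_right (hS.dist_cocycle_add_le y n m x) _)

variable [MeasurableSpace X] {μ : Measure X}

theorem IsNonexpansiveSemigroup.integrable_displacement (hS : IsNonexpansiveSemigroup S)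
    (hT : MeasurePreserving T μ μ) {y : D}
    (hmeas : ∀ n : ℕ, AEMeasurable (fun x => dist y (cocycle T w n x y)) μ)
    (hint : Integrable (fun x => dist y (cocycle T w 1 x y)) μ) (n : ℕ) :
    Integrable (fun x => dist y (cocycle T w n x y)) μ := by
  induction n with
  | zero => simp [cocycle]
  | succ n ih =>
    refine (ih.add ((hT.iterate n).integrable_comp_of_integrable hint)).mono'
      (hmeas (n + 1)).aestronglyMeasurable (Eventually.of_forall fun x => ?_)
    rw [Real.norm_of_nonneg dist_nonneg]
    exact hS.displacement_add_le y n 1 x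

theorem IsNonexpansiveSemigroup.subadditive_integral (hS : IsNonexpansiveSemigroup S)
    (hT : MeasurePreserving T μ μ) {y : D}
    (hint : ∀ n, Integrable (fun x => dist y (cocycle T w n x y)) μ) :
    Subadditive fun n => ∫ x, dist y (cocycle T w n x y) ∂μ := by
  intro n m
  have hmp := hT.iterate n
  have h1 : ∫ x, dist y (cocycle T w m (T^[n] x) y) ∂μ = ∫ x, dist y (cocycle T w m x y) ∂μ :=
    integral_comp_measurePreserving hmp (hint m).aestronglyMeasurable
  beta_reduce
  have h2 : Integrable (fun x => dist y (cocycle T w m (T^[n] x) y)) μ :=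
    hmp.integrable_comp_of_integrable (hint m)
  rw [← h1, ← integral_add (hint n) h2]
  exact integral_mono (hint _) ((hint n).add h2) fun x => hS.displacement_add_le y n m x

theorem bddBelow_integral_displacement (y : D) :
    BddBelow (Set.range fun n : ℕ => (∫ x, dist y (cocycle T w n x y) ∂μ) / n) :=
  ⟨0, by
    rintro _ ⟨n, rfl⟩
    exact div_nonneg (integral_nonneg fun _ => dist_nonneg) n.cast_nonneg⟩

theorem drift_eq_lim {y : D} (h : Subadditive fun n => ∫ x, dist y (cocycle T w n x y) ∂μ) :
    drift μ T w y = h.lim := by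
  refine Tendsto.limUnder_eq ((h.tendsto_lim (bddBelow_integral_displacement y)).congr fun n => ?_)
  rw [one_div, inv_mul_eq_div]

end Cocycle

end GeodErg

end

/-! ### Combination of the ergodic and geometric halves. -/

theorem theorem1
    {X : Type*} [MeasurableSpace X] (μ : Measure X) [IsProbabilityMeasure μ]
    (T : X → X) (hT : Ergodic T μ)
    {Y : Type*} [MetricSpace Y] [CompleteSpace Y]
    (hgeod : GeodErg.IsGeodesicSpace Y)
    (hbus : GeodErg.IsBusemannConvex Y)
    (hwuc : GeodErg.IsWeaklyUniformlyConvex Y)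
    (hmod : GeodErg.HasLargeScaleModulus Y)
    (D : Set Y) (S : Set C(D, D)) (hS : GeodErg.IsNonexpansiveSemigroup S)
    (w : X → S)
    -- `w` is measurable for the Borel sigma-algebra of the compact-open topology on `S`
    (hw : Measurable[_, borel S] w)
    (y : D)
    -- the displacements are measurable, so that their integrals make sense
    -- (this follows from `hw` as soon as `D` is separable)
    (hmeas : ∀ n : ℕ, AEMeasurable (fun x => dist y (GeodErg.cocycle T w n x y)) μ)
    (hint : Integrable (fun x => dist y (GeodErg.cocycle T w 1 x y)) μ)
    (hA : 0 < GeodErg.drift μ T w y) :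
    ∀ᵐ x ∂μ, ∃! γ : ℝ≥0 → Y, GeodErg.IsGeodesicRay (y : Y) γ ∧
      Tendsto (fun n : ℕ => (1 / (n : ℝ)) *
        dist (γ (Real.toNNReal (GeodErg.drift μ T w y * n))) (GeodErg.cocycle T w n x y : Y))
        atTop (𝓝 0) := by
  set A := GeodErg.drift μ T w y
  set f : ℕ → X → ℝ := fun n x => dist y (GeodErg.cocycle T w n x y)
  have hf : ∀ n, Integrable (f n) μ :=
    hS.integrable_displacement hT.toMeasurePreserving hmeas hint
  have hsub : ∀ n m x, f (n + m) x ≤ f n x + f m (T^[n] x) := hS.displacement_add_le y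
  have hsub1 : ∀ n x, f (n + 1) x ≤ f 1 x + f n (T x) := fun n x => by
    rw [add_comm]
    exact hsub 1 n x
  have h0 : ∀ x, f 0 x ≤ 0 := fun x => (dist_self y).le
  have hsa : Subadditive fun n => ∫ x, f n x ∂μ :=
    hS.subadditive_integral hT.toMeasurePreserving hf
  have hAlim : A = hsa.lim := GeodErg.drift_eq_lim hsa
  have hbdd : BddBelow (Set.range fun n : ℕ => (∫ x, f n x ∂μ) / n) :=
    GeodErg.bddBelow_integral_displacement y
  -- By Fekete, A is the infimum of the averages and not just their limit.
  have hlow : ∀ n : ℕ, A * n ≤ ∫ x, f n x ∂μ := fun n => by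
    rcases Nat.eq_zero_or_pos n with rfl | hn
    · simpa using integral_nonneg fun x => dist_nonneg
    · have := hsa.lim_le_div hbdd hn.ne'
      rwa [le_div_iff₀ (Nat.cast_pos.2 hn), ← hAlim] at this
  have hupper : ∀ᵐ x ∂μ, ∀ m : ℕ, ∀ᶠ n : ℕ in atTop, f n x ≤ (A + 1 / ((m : ℝ) + 1)) * n := by
    refine ae_all_iff.2 fun m => ?_
    have hev := (hsa.tendsto_lim hbdd).eventually
      (gt_mem_nhds (lt_add_of_pos_right hsa.lim (Nat.one_div_pos_of_nat (n := m))))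
    obtain ⟨M, hM, hM0⟩ := (hev.and (eventually_gt_atTop 0)).exists
    rw [← hAlim, div_lt_iff₀ (Nat.cast_pos.2 hM0)] at hM
    exact GeodErg.ae_eventually_le_of_subadditive hT hf hsub hM0 hM
  filter_upwards [hupper, GeodErg.ae_mem_goodSet hT hf h0 hsub1 hlow] with x hx1 hx2
  have hu : ∀ ε > 0, ∀ᶠ n : ℕ in atTop,
      |dist (y : Y) (GeodErg.cocycle T w n x y : Y) - A * n| ≤ ε * n := fun ε hε => by
    obtain ⟨m, hm⟩ := exists_nat_one_div_lt hε
    filter_upwards [hx1 m, GeodErg.eventually_le_of_mem_goodSet hsub hx2 hε] with n h1 h2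
    have h3 : 1 / ((m : ℝ) + 1) * n ≤ ε * n := mul_le_mul_of_nonneg_right hm.le n.cast_nonneg
    change |f n x - A * n| ≤ ε * n
    exact abs_le.2 ⟨by linarith, by linarith⟩
  have hgood : ∀ ε > 0, ∃ K : ℕ, ∀ N : ℕ, ∃ n ≥ N, ∀ k, K ≤ k → k ≤ n →
      dist (GeodErg.cocycle T w k x y : Y) (GeodErg.cocycle T w n x y : Y) + (A - ε) * k ≤
        dist (y : Y) (GeodErg.cocycle T w n x y : Y) := fun ε hε => by
    obtain ⟨K, hK⟩ := hx2 ε hε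
    refine ⟨K, fun N => ?_⟩
    obtain ⟨n, hn, h⟩ := hK N
    refine ⟨n, hn, fun k h1 h2 => le_trans (add_le_add_left ?_ _) (h k h1 h2)⟩
    have h3 := hS.dist_cocycle_add_le (T := T) (w := w) y k (n - k) x
    rwa [Nat.add_sub_cancel' h2] at h3
  obtain ⟨γ, hγ, hlim⟩ := GeodErg.exists_geodesicRay hgeod hbus hmod (y : Y) hA hu hgood
  exact ⟨γ, ⟨hγ, hlim⟩, fun γ' h' => GeodErg.geodesicRay_unique hbus hA h'.1 hγ h'.2 hlim⟩
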